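/- Let $p \ge 2$, $s > 0$, $0 \le \mu \le L$ and $r > 0$ be real numbers, and let $d, N$ be integers with $1 \le N \le \frac{d-1}{2}$. Let $$Q_\star = \frac{L + s r^{p-2}}{\mu + s r^{p-2}} \;\ge\; 1 .$$ A first-order method is a sequence of arbitrary maps $\mathcal M_0, \mathcal M_1, \ldots$ which, applied to a differentiable function $f : \mathbb{R}^d \to \mathbb{R}$, generates the points $x_0 = 0$ and $x_{k+1} = \mathcal M_k\big((f(x_0), \nabla f(x_0)), \ldots, (f(x_k), \nabla f(x_k))\big)$ for $k \ge 0$. For every first-order method there are a symmetric positive semidefinite matrix $A \in \mathbb{R}^{d\times d}$ with $\lambda_{\min}(A) = \mu$ and $\lambda_{\max}(A) = L$ and a vector $b \in \mathbb{R}^d$ such that the regularized quadratic function $$f(x) = \tfrac12 x^\top A x - b^\top x + \tfrac{s}{p}\|x\|^p, \qquad x \in \mathbb{R}^d$$ (with the Euclidean norm), has a unique minimizer $x_\star$, this minimizer satisfies $\|x_\star\| = r$, and, with $f_\star = f(x_\star)$, the point $x_N$ which the method generates on $f$ satisfies all three of $$\|x_N - x_\star\| \;\ge\; r \exp\Big(-\frac{8N}{\sqrt{Q_\star}-1}\Big),$$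 $$f(x_N) - f_\star \;\ge\; \frac{s}{p\,2^{p-2}}\, r^p \exp\Big(-\frac{8pN}{\sqrt{Q_\star}-1}\Big),$$ $$\|\nabla f(x_N)\| \;\ge\; \frac{2^{2-p}\, s}{(p-1)^{(p-1)/p}}\, r^{p-1} \exp\Big(-\frac{8(p-1)N}{\sqrt{Q_\star}-1}\Big).$$ When $Q_\star = 1$ (that is, $\mu = L$), the three exponential factors are read as $\exp(-\infty) = 0$. -/

import Mathlib

open Real

noncomputable section

/-- The regularized quadratic `f(x) = ½ xᵀ A x - bᵀ x + (s/p) ‖x‖ᵖ` on Euclidean `ℝᵈ`. -/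
def regQuad {d : ℕ} (A : Matrix (Fin d) (Fin d) ℝ) (b : EuclideanSpace ℝ (Fin d)) (s p : ℝ)
    (x : EuclideanSpace ℝ (Fin d)) : ℝ :=
  (1 / 2) * inner ℝ x (Matrix.toEuclideanLin A x) - inner ℝ b x + (s / p) * ‖x‖ ^ p

/-- The first-order black-box oracle `x ↦ (f(x), ∇f(x))`. -/
def firstOrderOracle {d : ℕ} (f : EuclideanSpace ℝ (Fin d) → ℝ)
    (x : EuclideanSpace ℝ (Fin d)) : ℝ × EuclideanSpace ℝ (Fin d) :=
  (f x, gradient f x)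

/-- A (deterministic) first-order method on `ℝᵈ`: a sequence of arbitrary maps `M 0, M 1, …`,
where `M k` sends the `k + 1` oracle answers obtained at `x₀, …, x_k` to the next point. -/
abbrev FirstOrderMethod (d : ℕ) : Type :=
  (k : ℕ) → (Fin (k + 1) → ℝ × EuclideanSpace ℝ (Fin d)) → EuclideanSpace ℝ (Fin d)

/-- The iterates of a first-order method on the objective `f`: `x₀ = 0` and
`x_{k+1} = M_k (oracle answers at x₀, …, x_k)`. -/
def FirstOrderMethod.iterate {d : ℕ} (M : FirstOrderMethod d)
    (f : EuclideanSpace ℝ (Fin d) → ℝ) : ℕ → EuclideanSpace ℝ (Fin d)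
  | 0 => 0
  | k + 1 => M k (fun i : Fin (k + 1) => firstOrderOracle f (FirstOrderMethod.iterate M f i.val))
decreasing_by exact i.isLt

/-- The modified condition number `(L + s r^{p-2}) / (μ + s r^{p-2})`. -/
def modifiedCond (p s μ L r : ℝ) : ℝ :=
  (L + s * r ^ (p - 2)) / (μ + s * r ^ (p - 2))

/-- The factor `exp (-c / (√Q - 1))` for `c > 0` and `Q ≥ 1`, with its limit `exp (-∞) = 0`
as value at `Q = 1` (where division by zero in `ℝ` would give `1`). -/
def expFactor (c Q : ℝ) : ℝ :=
  if Q = 1 then 0 else Real.exp (-(c / (√Q - 1)))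

end

/-!
The objective is a quadratic with one extra radial term, and two facts about it carry the proof.

*Reduction to distance.* For `p ≥ 2` the field `x ↦ ‖x‖ ^ (p - 2) • x` is uniformly monotone with
the sharp constant `2 ^ (2 - p)` (`inner_norm_rpow_smul_sub_ge`). Hence both the gap
`f x - f x⋆` and `‖∇f x‖` are bounded below by powers of `‖x - x⋆‖` (`regQuad_sub_ge`,
`norm_gradient_regQuad_ge`), and only the bound on `‖x_N - x⋆‖` remains. The minimizer is the
solution of `(A + s r ^ (p - 2)) x⋆ = b` when this solution has norm `r`, so that `f` behaves like a
quadratic with condition number `Q⋆`.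

*Resisting oracle.* At a point of the Krylov space `K j = {q(A) b : deg q < j}` the gradient of `f`
lies in `K (j + 1)`, since the radial term only adds a multiple of the point. After each query
the objective can be rotated by a reflection which fixes everything the method has already seen
and moves the new query point into the Krylov space two dimensions larger. So for every method some
rotated copy of `f` has its `N`-th iterate in the rotated `K (2 * N)`
(`exists_resisting_rotation`). A rotation changes neither the spectrum of `A` nor any norm.

*Hard spectrum.* It remains to find `A` and `x⋆` for which all points of `K n`, `n = 2 * N`, are
far from `x⋆`. The eigenvalues of `A` are the `n + 1` extremal points of the Chebyshev polynomial
`T n`, transported to `[μ, L]`. With `κ = (Q⋆ + 1) / (Q⋆ - 1)` the position of the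
eigenvalue `- s r ^ (p - 2)` in the Chebyshev variable, Lagrange interpolation at `κ` has
coefficients of alternating signs `(-1) ^ i * w i`, `w i > 0` (`exists_chebyshev_weights`). Take
the coordinates of `x⋆` proportional to `√(w i)`, and `z i = (-1) ^ i * √(w i)`. Elements of
`K n` correspond to polynomials that vanish at `κ`, so `z` is orthogonal to `K n`, whence
`‖u - x⋆‖ ≥ ⟪z, x⋆⟫ / ‖z‖ = r / T n κ` for `u ∈ K n` (`exists_hard_diagonal`). Finally
`T n κ ≤ exp (2 n / (√Q⋆ - 1))` (`chebyshev_T_eval_le`).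
-/

open scoped InnerProductSpace

/-! ### Uniform convexity of the regularized quadratic -/

/-- The scalar form of the uniform monotonicity of `x ↦ ‖x‖ ^ (p - 2) • x`, with `a = ‖x‖`,
`b = ‖y‖` and `D = ‖x - y‖ ^ 2`. The left side is convex and the right side affine in `D`, so it
suffices to compare them at the two ends of the interval, where `x` and `y` are collinear. -/
theorem rpow_half_le_affine {p a b D : ℝ} (hp : 2 ≤ p) (ha : 0 ≤ a) (hb : 0 ≤ b)
    (hD : D ∈ Set.Icc ((a - b) ^ 2) ((a + b) ^ 2)) :
    2 ^ (2 - p) * D ^ (p / 2) ≤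
      (a ^ (p - 2) + b ^ (p - 2)) / 2 * D + (a ^ (p - 2) - b ^ (p - 2)) * (a ^ 2 - b ^ 2) / 2 := by
  wlog hab : b ≤ a generalizing a b
  · have := this hb ha (by rw [← neg_sub, neg_sq, add_comm]; exact hD) (le_of_not_ge hab)
    linarith
  have e : ∀ x : ℝ, 0 ≤ x → x ^ (p - 1) = x ^ (p - 2) * x := fun x hx => by
    rw [← Real.rpow_add_one' hx (by linarith)]; ring_nf
  have e' : ∀ x : ℝ, 0 ≤ x → (x ^ 2) ^ (p / 2) = x ^ (p - 1) * x := fun x hx => by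
    rw [← Real.rpow_add_one' hx (by linarith), ← Real.rpow_natCast, ← Real.rpow_mul hx]
    congr 1; push_cast; ring
  set m := (a ^ (p - 2) + b ^ (p - 2)) / 2 with hm
  set k := (a ^ (p - 2) - b ^ (p - 2)) * (a ^ 2 - b ^ 2) / 2 with hk
  have hconv : ConvexOn ℝ (Set.Ici 0) (fun x : ℝ => 2 ^ (2 - p) * x ^ (p / 2) + (-m) * x) := by
    refine ((convexOn_rpow (by linarith)).smul (by positivity)).add ?_
    exact (LinearMap.mul ℝ ℝ (-m)).convexOn (convex_Ici 0)
  have hmax := hconv.le_max_of_mem_Icc (Set.mem_Ici.2 (sq_nonneg (a - b)))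
    (Set.mem_Ici.2 (sq_nonneg (a + b))) hD
  -- `x` and `y` on the same ray: superadditivity of `t ↦ t ^ (p - 1)`
  have hlow : 2 ^ (2 - p) * ((a - b) ^ 2) ^ (p / 2) ≤ m * (a - b) ^ 2 + k := by
    rw [e' _ (sub_nonneg.2 hab)]
    have h1 : (a - b) ^ (p - 1) + b ^ (p - 1) ≤ a ^ (p - 1) := by
      simpa using Real.add_rpow_le_rpow_add (sub_nonneg.2 hab) hb (by linarith : 1 ≤ p - 1)
    have h2 : (2 : ℝ) ^ (2 - p) ≤ 1 :=
      Real.rpow_le_one_of_one_le_of_nonpos (by norm_num) (by linarith)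
    have h3 : 0 ≤ (a - b) ^ (p - 1) * (a - b) :=
      mul_nonneg (Real.rpow_nonneg (sub_nonneg.2 hab) _) (sub_nonneg.2 hab)
    calc _ ≤ 1 * ((a - b) ^ (p - 1) * (a - b)) := by gcongr
      _ ≤ (a ^ (p - 1) - b ^ (p - 1)) * (a - b) := by
        rw [one_mul]; exact mul_le_mul_of_nonneg_right (by linarith) (sub_nonneg.2 hab)
      _ = _ := by rw [e a ha, e b hb, hm, hk]; ring
  -- `x` and `y` on opposite rays: midpoint convexity of `t ↦ t ^ (p - 1)`
  have hhigh : 2 ^ (2 - p) * ((a + b) ^ 2) ^ (p / 2) ≤ m * (a + b) ^ 2 + k := by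
    rw [e' _ (add_nonneg ha hb)]
    have h1 : ((a + b) / 2) ^ (p - 1) ≤ (a ^ (p - 1) + b ^ (p - 1)) / 2 := by
      have := (convexOn_rpow (by linarith : 1 ≤ p - 1)).2 (Set.mem_Ici.2 ha) (Set.mem_Ici.2 hb)
        (by norm_num : (0 : ℝ) ≤ 1 / 2) (by norm_num : (0 : ℝ) ≤ 1 / 2) (by norm_num)
      simp only [smul_eq_mul] at this
      rw [show (a + b) / 2 = 1 / 2 * a + 1 / 2 * b by ring]
      exact this.trans_eq (by ring)
    rw [Real.div_rpow (add_nonneg ha hb) (by norm_num)] at h1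
    have h2 : (2 : ℝ) ^ (2 - p) = 2 * (1 / 2 ^ (p - 1)) := by
      rw [show (2 : ℝ) - p = 1 - (p - 1) by ring, Real.rpow_sub (by norm_num), Real.rpow_one]; ring
    calc _ = 2 * ((a + b) ^ (p - 1) / 2 ^ (p - 1)) * (a + b) := by rw [h2]; ring
      _ ≤ 2 * ((a ^ (p - 1) + b ^ (p - 1)) / 2) * (a + b) := by gcongr
      _ = _ := by rw [e a ha, e b hb, hm, hk]; ring
  have := hmax.trans (max_le (show _ ≤ k by linarith) (show _ ≤ k by linarith))
  linarith

section
variable {E : Type*} [NormedAddCommGroup E] [InnerProductSpace ℝ E]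

theorem inner_norm_rpow_smul_sub_ge {p : ℝ} (hp : 2 ≤ p) (x y : E) :
    2 ^ (2 - p) * ‖x - y‖ ^ p ≤
      ⟪‖x‖ ^ (p - 2) • x - ‖y‖ ^ (p - 2) • y, x - y⟫_ℝ := by
  have h := rpow_half_le_affine hp (norm_nonneg x) (norm_nonneg y) (D := ‖x - y‖ ^ 2)
    ⟨by rw [sq_le_sq, abs_norm]; exact abs_norm_sub_norm_le x y,
      by gcongr; exact norm_sub_le x y⟩
  have e : (‖x - y‖ ^ 2) ^ (p / 2) = ‖x - y‖ ^ p := by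
    rw [← Real.rpow_natCast, ← Real.rpow_mul (norm_nonneg _)]; congr 1; push_cast; ring
  rw [e] at h
  refine h.trans_eq ?_
  have := norm_sub_sq_real x y
  simp only [inner_sub_left, inner_sub_right, real_inner_smul_left, real_inner_self_eq_norm_sq,
    real_inner_comm x y] at this ⊢
  rw [this]; ring
end

section
variable {d : ℕ} {A : Matrix (Fin d) (Fin d) ℝ} {b xs : EuclideanSpace ℝ (Fin d)} {s p : ℝ}

theorem hasGradientAt_regQuad (hA : A.IsHermitian) (b : EuclideanSpace ℝ (Fin d)) (s : ℝ)
    (hp : 2 ≤ p) (x : EuclideanSpace ℝ (Fin d)) :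
    HasGradientAt (regQuad A b s p)
      (Matrix.toEuclideanLin A x - b + (s * ‖x‖ ^ (p - 2)) • x) x := by
  have hsym := Matrix.isSymmetric_toEuclideanLin_iff.2 hA
  rw [hasGradientAt_iff_hasFDerivAt]
  have hT : HasFDerivAt (fun y => Matrix.toEuclideanLin A y)
      (Matrix.toEuclideanLin A).toContinuousLinearMap x :=
    (Matrix.toEuclideanLin A).toContinuousLinearMap.hasFDerivAt
  have h1 := (((hasFDerivAt_id x).inner ℝ hT).const_mul (1 / 2)).sub
    ((innerSL ℝ b).hasFDerivAt (x := x))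
  have h2 := h1.add ((hasFDerivAt_norm_rpow x (by linarith : 1 < p)).const_mul (s / p))
  refine h2.congr_fderiv ?_
  ext y
  have h3 := hsym x y
  have hp0 : p ≠ 0 := by linarith
  simp only [add_apply, sub_apply,
    smul_apply, ContinuousLinearMap.comp_apply, ContinuousLinearMap.prod_apply,
    ContinuousLinearMap.id_apply, fderivInnerCLM_apply, innerSL_apply_apply, id_eq, smul_eq_mul,
    LinearMap.coe_toContinuousLinearMap', InnerProductSpace.toDual_apply_apply, inner_add_left,
    inner_sub_left, real_inner_smul_left]
  rw [← h3, real_inner_comm _ y]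
  field_simp
  ring

theorem inner_grad_regQuad_ge (hA : A.PosSemidef) (hs : 0 ≤ s) (hp : 2 ≤ p)
    (hxs : gradient (regQuad A b s p) xs = 0) (x : EuclideanSpace ℝ (Fin d)) :
    s * 2 ^ (2 - p) * ‖x - xs‖ ^ p ≤ ⟪gradient (regQuad A b s p) x, x - xs⟫_ℝ := by
  have h0 := (hasGradientAt_regQuad hA.1 b s hp xs).gradient.symm.trans hxs
  have h1 := mul_le_mul_of_nonneg_left (inner_norm_rpow_smul_sub_ge hp x xs) hs
  have h2 : 0 ≤ ⟪Matrix.toEuclideanLin A (x - xs), x - xs⟫_ℝ :=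
    (Matrix.isPositive_toEuclideanLin_iff.2 hA).2 _
  have h3 : gradient (regQuad A b s p) x = Matrix.toEuclideanLin A (x - xs) +
      s • (‖x‖ ^ (p - 2) • x - ‖xs‖ ^ (p - 2) • xs) := by
    rw [(hasGradientAt_regQuad hA.1 b s hp x).gradient, ← sub_zero (_ + _), ← h0, map_sub,
      smul_sub, smul_smul, smul_smul]
    abel
  rw [h3, inner_add_left, real_inner_smul_left]
  linarith

theorem norm_gradient_regQuad_ge (hA : A.PosSemidef) (hs : 0 ≤ s) (hp : 2 ≤ p)
    (hxs : gradient (regQuad A b s p) xs = 0) (x : EuclideanSpace ℝ (Fin d)) :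
    2 ^ (2 - p) * s * ‖x - xs‖ ^ (p - 1) ≤ ‖gradient (regQuad A b s p) x‖ := by
  rcases eq_or_ne x xs with rfl | hx
  · simp [Real.zero_rpow (by linarith : p - 1 ≠ 0)]
  have h0 : 0 < ‖x - xs‖ := norm_pos_iff.2 (sub_ne_zero.2 hx)
  refine le_of_mul_le_mul_right ?_ h0
  calc _ = s * 2 ^ (2 - p) * ‖x - xs‖ ^ p := by
        rw [mul_assoc, ← Real.rpow_add_one h0.ne']; ring_nf
    _ ≤ _ := inner_grad_regQuad_ge hA hs hp hxs x
    _ ≤ _ := real_inner_le_norm _ _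

/-- A critical point is the unique minimizer, with growth of order `p` around it: the strong
monotonicity of the gradient is integrated along the segment from `xs` to `x`. -/
theorem regQuad_sub_ge (hA : A.PosSemidef) (hs : 0 ≤ s) (hp : 2 ≤ p)
    (hxs : gradient (regQuad A b s p) xs = 0) (x : EuclideanSpace ℝ (Fin d)) :
    s / (p * 2 ^ (p - 2)) * ‖x - xs‖ ^ p ≤ regQuad A b s p x - regQuad A b s p xs := by
  set h := x - xs with hh
  set f := regQuad A b s p
  set c := s / (p * 2 ^ (p - 2)) * ‖h‖ ^ p with hc
  have hp0 : (0 : ℝ) < p := by linarith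
  have hline : ∀ t : ℝ, HasDerivAt (fun t : ℝ => xs + t • h) h t := fun t => by
    simpa using ((hasDerivAt_id t).smul_const h).const_add xs
  have hder : ∀ t : ℝ, HasDerivAt (fun t : ℝ => f (xs + t • h) - c * t ^ p)
      (⟪gradient f (xs + t • h), h⟫_ℝ - c * (p * t ^ (p - 1))) t := by
    intro t
    have hg := hasGradientAt_regQuad hA.1 b s hp (xs + t • h)
    rw [← hg.gradient, hasGradientAt_iff_hasFDerivAt] at hg
    have h1 := hg.comp_hasDerivAt t (hline t)
    have h2 := (Real.hasDerivAt_rpow_const (x := t) (p := p) (Or.inr (by linarith))).const_mul c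
    exact h1.sub h2
  have hmono : MonotoneOn (fun t : ℝ => f (xs + t • h) - c * t ^ p) (Set.Icc 0 1) := by
    refine monotoneOn_of_deriv_nonneg (convex_Icc 0 1)
      (fun t _ => (hder t).continuousAt.continuousWithinAt)
      (fun t _ => (hder t).differentiableAt.differentiableWithinAt) fun t ht => ?_
    rw [interior_Icc] at ht
    rw [(hder t).deriv, sub_nonneg]
    refine le_of_mul_le_mul_left ?_ ht.1
    have h1 := inner_grad_regQuad_ge hA hs hp hxs (xs + t • h)
    rw [add_sub_cancel_left, real_inner_smul_right, norm_smul, Real.norm_of_nonneg ht.1.le,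
      Real.mul_rpow ht.1.le (norm_nonneg _)] at h1
    refine le_trans (le_of_eq ?_) h1
    rw [hc, show (2 : ℝ) - p = -(p - 2) by ring, Real.rpow_neg (by norm_num),
      show t ^ p = t ^ (p - 1) * t by rw [← Real.rpow_add_one ht.1.ne']; ring_nf]
    field_simp
  have := hmono (by simp) (by simp) zero_le_one
  simp [Real.zero_rpow hp0.ne', hh] at this
  linarith

end

/-! ### The resisting oracle -/

section
variable {E : Type*} [NormedAddCommGroup E] [InnerProductSpace ℝ E]

theorem gradient_comp_linearIsometryEquiv [CompleteSpace E] (f : E → ℝ) (U : E ≃ₗᵢ[ℝ] E)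
    (x : E) :
    gradient (fun y => f (U y)) x = U.symm (gradient f (U x)) := by
  refine (InnerProductSpace.toDual ℝ E).injective ?_
  ext y
  have h := U.toContinuousLinearEquiv.comp_right_fderiv (f := f) (x := x)
  have h' : fderiv ℝ (fun y => f (U y)) x y = fderiv ℝ f (U x) (U y) :=
    DFunLike.congr_fun h y
  have h2 : ⟪U.symm (gradient f (U x)), y⟫_ℝ = ⟪gradient f (U x), U y⟫_ℝ := by
    rw [← U.inner_map_map, U.apply_symm_apply]
  simp only [InnerProductSpace.toDual_apply_apply, h2]
  simp [gradient, h']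

/-- A vector `y` can be rotated into a subspace strictly containing `K` without moving `K`: a
reflection takes the component of `y` orthogonal to `K` to a multiple of a vector of `K' ⊓ Kᗮ`. -/
theorem exists_linearIsometryEquiv_fixing_and_mem {K K' : Submodule ℝ E} [K.HasOrthogonalProjection]
    [FiniteDimensional ℝ E] (hK : K < K') (y : E) :
    ∃ V : E ≃ₗᵢ[ℝ] E, (∀ x ∈ K, V x = x) ∧ V y ∈ K' := by
  obtain ⟨v, hv', hv⟩ := SetLike.exists_of_lt hK
  set u := v - K.starProjection v with hu
  have huK : u ∈ Kᗮ := K.sub_starProjection_mem_orthogonal v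
  have huK' : u ∈ K' := sub_mem hv' (hK.le (K.starProjection_apply_mem v))
  have hu0 : u ≠ 0 := fun h => hv (by rw [sub_eq_zero.1 h]; exact K.starProjection_apply_mem v)
  set z := y - K.starProjection y with hz
  have hzK : z ∈ Kᗮ := K.sub_starProjection_mem_orthogonal y
  set w := (‖z‖ / ‖u‖) • u with hw
  have hzw : ‖z‖ = ‖w‖ := by
    rw [hw, norm_smul, norm_div, norm_norm, norm_norm, div_mul_cancel₀ _ (norm_ne_zero_iff.2 hu0)]
  have hfix : ∀ x ∈ K, (ℝ ∙ (z - w))ᗮ.reflection x = x := fun x hx => by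
    apply Submodule.reflection_mem_subspace_eq_self
    rw [Submodule.mem_orthogonal_singleton_iff_inner_right]
    exact Submodule.inner_left_of_mem_orthogonal hx (sub_mem hzK (Kᗮ.smul_mem _ huK))
  refine ⟨(ℝ ∙ (z - w))ᗮ.reflection, hfix, ?_⟩
  have : y = K.starProjection y + z := by rw [hz]; abel
  rw [this, map_add, hfix _ (K.starProjection_apply_mem y), Submodule.reflection_sub hzw]
  exact add_mem (hK.le (K.starProjection_apply_mem y)) (K'.smul_mem _ huK')
end

variable {d : ℕ}

theorem FirstOrderMethod.iterate_succ (M : FirstOrderMethod d) (f : EuclideanSpace ℝ (Fin d) → ℝ)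
    (k : ℕ) : M.iterate f (k + 1) =
      M k (fun i : Fin (k + 1) => firstOrderOracle f (M.iterate f i.val)) := by
  rw [FirstOrderMethod.iterate]

/-- If two objectives answer alike at the first `k` iterates on `f`, then the method cannot tell
them apart until it has produced `x_k`. -/
theorem FirstOrderMethod.iterate_congr (M : FirstOrderMethod d)
    {f g : EuclideanSpace ℝ (Fin d) → ℝ} {k : ℕ}
    (h : ∀ i < k, firstOrderOracle f (M.iterate f i) = firstOrderOracle g (M.iterate f i)) :
    ∀ i ≤ k, M.iterate f i = M.iterate g i := by
  intro i
  induction i using Nat.strong_induction_on with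
  | _ i ih =>
    intro hi
    cases i with
    | zero => rw [FirstOrderMethod.iterate, FirstOrderMethod.iterate]
    | succ j =>
      rw [M.iterate_succ, M.iterate_succ]
      congr 1
      funext ⟨i, hij⟩
      simp only
      rw [h i (by omega), ih i hij (by omega)]

/-- The resisting oracle: if the gradient of `f` climbs the flag `W` by at most one step, then `f`
can be rotated so that each query of `M` gains at most two steps of the flag, one for the query
point and one for the gradient there. -/
theorem exists_resisting_rotation (M : FirstOrderMethod d) (f : EuclideanSpace ℝ (Fin d) → ℝ)
    (W : ℕ → Submodule ℝ (EuclideanSpace ℝ (Fin d))) (hmono : Monotone W)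
    (hgrad : ∀ j, ∀ x ∈ W j, gradient f x ∈ W (j + 1)) (N : ℕ)
    (hlt : ∀ j < 2 * N, W j < W (j + 1)) :
    ∃ U : EuclideanSpace ℝ (Fin d) ≃ₗᵢ[ℝ] EuclideanSpace ℝ (Fin d),
      ∀ k ≤ N, U (M.iterate (fun x => f (U x)) k) ∈ W (2 * k) := by
  induction N with
  | zero =>
    refine ⟨LinearIsometryEquiv.refl ℝ _, fun k hk => ?_⟩
    obtain rfl : k = 0 := by omega
    rw [FirstOrderMethod.iterate, map_zero]
    exact zero_mem _
  | succ n ih =>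
    obtain ⟨U, hU⟩ := ih fun j hj => hlt j (by omega)
    -- All answers so far lie in `W (2 * n + 1)`, so a rotation fixing this space keeps them valid.
    obtain ⟨V, hV, hVy⟩ := exists_linearIsometryEquiv_fixing_and_mem
      (hlt (2 * n + 1) (by omega)) (U (M.iterate (fun x => f (U x)) (n + 1)))
    have hV' : ∀ x ∈ W (2 * n + 1), V.symm x = x := fun x hx =>
      V.injective (by rw [V.apply_symm_apply, hV x hx])
    have horacle : ∀ i < n + 1,
        firstOrderOracle (fun x => f (U x)) (M.iterate (fun x => f (U x)) i) =
        firstOrderOracle (fun x => f (U.trans V x)) (M.iterate (fun x => f (U x)) i) := by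
      intro i hi
      have hm := hU i (by omega)
      have hm1 := hV _ (hmono (by omega : 2 * i ≤ 2 * n + 1) hm)
      have hm2 := hV' _ (hmono (by omega : 2 * i + 1 ≤ 2 * n + 1) (hgrad _ _ hm))
      rw [firstOrderOracle, firstOrderOracle, gradient_comp_linearIsometryEquiv,
        gradient_comp_linearIsometryEquiv, LinearIsometryEquiv.trans_apply, hm1,
        LinearIsometryEquiv.symm_trans, LinearIsometryEquiv.trans_apply, hm2]
    have hiter := M.iterate_congr horacle
    refine ⟨U.trans V, fun k hk => ?_⟩
    rw [← hiter k hk, LinearIsometryEquiv.trans_apply]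
    rcases Nat.lt_or_ge n k with h | h
    · obtain rfl : k = n + 1 := by omega
      exact hVy
    · have hm := hU k h
      rwa [hV _ (hmono (by omega) hm)]

/-! ### A diagonal operator with hard Krylov spaces -/

section
open Polynomial Polynomial.Chebyshev

/-- Interpolation at the extremal points of `T n`, evaluated to the right of `[-1, 1]`, has
coefficients of strictly alternating signs. -/
theorem exists_chebyshev_weights (n : ℕ) {κ : ℝ} (hκ : 1 < κ) :
    ∃ w : ℕ → ℝ, (∀ i ≤ n, 0 < w i) ∧ ∀ q : ℝ[X], q.degree < (n + 1 : ℕ) →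
      ∑ i ∈ Finset.range (n + 1), (-1) ^ i * w i * q.eval (node n i) = q.eval κ := by
  have hinj : Set.InjOn (node n) (Finset.range (n + 1)) := (strictAntiOn_node n).injOn
  refine ⟨fun i => (-1) ^ i * (Lagrange.basis (Finset.range (n + 1)) (node n) i).eval κ,
    fun i hi => ?_, fun q hq => ?_⟩
  · have h1 := zero_lt_prod_node_sub_node hi
    have h2 : 0 < ∏ j ∈ (Finset.range (n + 1)).erase i, (κ - node n j) :=
      Finset.prod_pos fun j _ => sub_pos.2 ((node_mem_Icc).2.trans_lt hκ)
    have h3 : (Lagrange.basis (Finset.range (n + 1)) (node n) i).eval κ =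
        (∏ j ∈ (Finset.range (n + 1)).erase i, (κ - node n j)) /
          ∏ j ∈ (Finset.range (n + 1)).erase i, (node n i - node n j) := by
      rw [Lagrange.basis, eval_prod, ← Finset.prod_div_distrib]
      refine Finset.prod_congr rfl fun j _ => ?_
      simp [Lagrange.basisDivisor, div_eq_inv_mul]
    simp only [h3]
    rcases neg_one_pow_eq_or ℝ i with h | h <;> rw [h] at h1 ⊢
    · rw [one_mul] at h1 ⊢; positivity
    · have : ∏ j ∈ (Finset.range (n + 1)).erase i, (node n i - node n j) < 0 := by linarith
      have := div_neg_of_pos_of_neg h2 this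
      linarith
  · have h := congrArg (Polynomial.eval κ)
      (Lagrange.eq_interpolate hinj (by rwa [Finset.card_range]) : q = _)
    rw [Lagrange.interpolate_apply, eval_finsetSum] at h
    rw [h]
    refine Finset.sum_congr rfl fun i _ => ?_
    have : ((-1 : ℝ) ^ i) * (-1) ^ i = 1 := by rw [← mul_pow]; simp
    rw [← mul_assoc, this, eval_mul, eval_C]
    ring

/-- The Chebyshev growth at `(Q + 1) / (Q - 1) = cosh (log q)`, where `q = (√Q + 1) / (√Q - 1)`, is
`cosh (n * log q) ≤ q ^ n`, and `log q ≤ q - 1 = 2 / (√Q - 1)`. -/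
theorem chebyshev_T_eval_le (n : ℕ) {Q : ℝ} (hQ : 1 < Q) :
    (T ℝ n).eval ((Q + 1) / (Q - 1)) ≤ exp (2 * n / (√Q - 1)) := by
  have h1 : 1 < √Q := by rwa [Real.lt_sqrt zero_le_one, one_pow]
  have hsq : √Q ^ 2 = Q := Real.sq_sqrt (by linarith)
  set r := √Q
  have hr : 0 < r - 1 := by linarith
  set q := (r + 1) / (r - 1) with hq
  have hq1 : 1 ≤ q := by rw [hq, one_le_div hr]; linarith
  have hq0 : 0 < q := by linarith
  have hc : (Q + 1) / (Q - 1) = cosh (log q) := by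
    rw [Real.cosh_log hq0, hq, ← hsq]
    have : r ^ 2 - 1 ≠ 0 := by nlinarith
    have : r + 1 ≠ 0 := by linarith
    field_simp
    ring
  have hlog : log q ≤ 2 / (r - 1) := by
    have := Real.log_le_sub_one_of_pos hq0
    have e : q - 1 = 2 / (r - 1) := by rw [hq]; field_simp; ring
    linarith
  rw [hc, T_real_cosh]
  have h0 : 0 ≤ log q := Real.log_nonneg hq1
  have hx : ∀ x : ℝ, 0 ≤ x → cosh x ≤ exp x := fun x hx => by
    rw [Real.cosh_eq]
    have : exp (-x) ≤ exp x := Real.exp_le_exp.2 (by linarith)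
    linarith
  refine (hx _ (by push_cast; positivity)).trans (Real.exp_le_exp.2 ?_)
  push_cast
  calc (n : ℝ) * log q ≤ n * (2 / (r - 1)) := by gcongr
    _ = _ := by ring

end

section krylov
open Polynomial

/-- The linear map `q ↦ q(Y) b`, where `Y` is the diagonal operator with entries `y`. -/
noncomputable def polyDiag (y b : Fin d → ℝ) : ℝ[X] →ₗ[ℝ] EuclideanSpace ℝ (Fin d) where
  toFun q := WithLp.toLp 2 fun i => q.eval (y i) * b i
  map_add' q q' := by ext i; simp [add_mul]
  map_smul' c q := by ext i; simp [mul_assoc]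

@[simp]
theorem polyDiag_apply (y b : Fin d → ℝ) (q : ℝ[X]) (i : Fin d) :
    polyDiag y b q i = q.eval (y i) * b i := rfl

/-- The `j`-th Krylov subspace `{q(Y) b : deg q < j}` of the diagonal operator `Y` with
entries `y`. -/
noncomputable def diagKrylov (y b : Fin d → ℝ) (j : ℕ) : Submodule ℝ (EuclideanSpace ℝ (Fin d)) :=
  (degreeLT ℝ j).map (polyDiag y b)

theorem mem_diagKrylov {y b : Fin d → ℝ} {j : ℕ} {x : EuclideanSpace ℝ (Fin d)} :
    x ∈ diagKrylov y b j ↔ ∃ q : ℝ[X], q.degree < j ∧ polyDiag y b q = x := by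
  simp [diagKrylov, mem_degreeLT]

theorem diagKrylov_mono (y b : Fin d → ℝ) : Monotone (diagKrylov y b) := fun _ _ h =>
  Submodule.map_mono (degreeLT_mono h)

theorem toLp_mem_diagKrylov_one (y b : Fin d → ℝ) : WithLp.toLp 2 b ∈ diagKrylov y b 1 :=
  mem_diagKrylov.2 ⟨1, by rw [degree_one]; norm_num, by ext i; simp⟩

theorem degree_affine_mul_lt {j : ℕ} {q : ℝ[X]} (α β : ℝ) (hq : q.degree < j) :
    ((C α - C β * X) * q).degree < ((j + 1 : ℕ) : WithBot ℕ) := by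
  have h1 : (C α - C β * X).degree ≤ 1 := by compute_degree
  rcases eq_or_ne q 0 with rfl | h0
  · rw [mul_zero, degree_zero]; exact WithBot.bot_lt_coe _
  rw [degree_eq_natDegree h0] at hq
  refine (degree_mul_le _ _).trans_lt ?_
  rw [degree_eq_natDegree h0]
  refine (add_le_add_left h1 _).trans_lt ?_
  norm_cast at hq ⊢
  omega

theorem diagonal_affine_mem_diagKrylov {y b : Fin d → ℝ} {j : ℕ} (α β : ℝ)
    {x : EuclideanSpace ℝ (Fin d)} (hx : x ∈ diagKrylov y b j) :
    Matrix.toEuclideanLin (Matrix.diagonal fun i => α - β * y i) x ∈ diagKrylov y b (j + 1) := by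
  obtain ⟨q, hq, rfl⟩ := mem_diagKrylov.1 hx
  refine mem_diagKrylov.2 ⟨(C α - C β * X) * q, ?_, ?_⟩
  · exact degree_affine_mul_lt α β hq
  · ext i
    simp [Matrix.toLpLin_apply, Matrix.mulVec_diagonal, mul_assoc]

/-- The Krylov flag grows strictly as long as its dimension is below the number of distinct
entries of `y` that carry a nonzero entry of `b`; the indices `e` select such entries. -/
theorem diagKrylov_lt_succ {y b : Fin d → ℝ} {n j : ℕ} {e : Fin (n + 1) → Fin d}
    (hy : Function.Injective (y ∘ e)) (hb : ∀ i, b (e i) ≠ 0) (hj : j ≤ n) :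
    diagKrylov y b j < diagKrylov y b (j + 1) := by
  refine (diagKrylov_mono y b j.le_succ).lt_of_ne fun h => ?_
  have hmem : polyDiag y b (X ^ j) ∈ diagKrylov y b (j + 1) :=
    mem_diagKrylov.2 ⟨X ^ j, by rw [degree_X_pow]; exact_mod_cast j.lt_succ_self, rfl⟩
  rw [← h] at hmem
  obtain ⟨q, hq, hqe⟩ := mem_diagKrylov.1 hmem
  have hdeg : q.degree < (X ^ j : ℝ[X]).degree := by rwa [degree_X_pow]
  have : q = X ^ j := by
    refine eq_of_degrees_lt_of_eval_index_eq (s := Finset.univ) (v := y ∘ e) (hy.injOn) ?_ ?_ ?_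
    · refine hq.trans_le ?_
      rw [Finset.card_fin]; exact_mod_cast (by omega)
    · rw [degree_X_pow, Finset.card_fin]; exact_mod_cast (by omega)
    · intro i _
      have := congrArg (fun v : EuclideanSpace ℝ (Fin d) => v (e i)) hqe
      simp only [polyDiag_apply] at this
      exact mul_right_cancel₀ (hb i) this
  exact hdeg.ne (by rw [this])

end krylov

section
open Polynomial Polynomial.Chebyshev

/-- A diagonal operator `h * (κ - Y)` and a point `xs` of norm `r` such that all of the `n`-th
Krylov space of `b = h * (κ - Y) xs` is at distance at least `r / T n κ` from `xs`. The entries of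
`Y` are the extremal points of `T n`, including both ends of `[-1, 1]`. -/
theorem exists_hard_diagonal {n : ℕ} (hn : 1 ≤ n) (hnd : n + 1 ≤ d) {κ h r : ℝ} (hκ : 1 < κ)
    (hh : 0 < h) (hr : 0 < r) :
    ∃ (y b : Fin d → ℝ) (xs : EuclideanSpace ℝ (Fin d)),
      (∀ i, y i ∈ Set.Icc (-1) 1) ∧ (∃ i, y i = 1) ∧ (∃ i, y i = -1) ∧
      ‖xs‖ = r ∧ (∀ i, h * (κ - y i) * xs i = b i) ∧
      (∀ j ≤ n, diagKrylov y b j < diagKrylov y b (j + 1)) ∧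
      ∀ u ∈ diagKrylov y b n, r / (T ℝ n).eval κ ≤ ‖u - xs‖ := by
  obtain ⟨w, hw, hq⟩ := exists_chebyshev_weights n hκ
  set τ := (T ℝ n).eval κ with hτ
  have hτ0 : 0 < τ := zero_lt_one.trans_le (one_le_eval_T_real n hκ.le)
  -- Coordinates beyond the `n + 1` nodes carry no weight; their entry of `y` only has to be in
  -- `[-1, 1]`.
  set y : Fin d → ℝ := fun i => if (i : ℕ) ≤ n then node n i else 1 with hy
  set W : Fin d → ℝ := fun i => if (i : ℕ) ≤ n then w i else 0 with hW
  have hW0 : ∀ i, 0 ≤ W i := fun i => by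
    simp only [hW]; split_ifs with hi
    · exact (hw _ hi).le
    · exact le_rfl
  have hyI : ∀ i, y i ∈ Set.Icc (-1) 1 := fun i => by
    simp only [hy]; split_ifs
    · exact node_mem_Icc
    · norm_num
  have hsum : ∀ q : ℝ[X], q.degree < (n + 1 : ℕ) →
      ∑ i : Fin d, (-1) ^ (i : ℕ) * W i * q.eval (y i) = q.eval κ := by
    intro q hqd
    rw [← hq q hqd, Fin.sum_univ_eq_sum_range
      (fun i : ℕ => (-1) ^ i * (if i ≤ n then w i else 0) * q.eval (if i ≤ n then node n i else 1)),
      ← Finset.sum_subset (Finset.range_mono hnd)]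
    · refine Finset.sum_congr rfl fun i hi => ?_
      have : i ≤ n := Nat.lt_succ_iff.1 (Finset.mem_range.1 hi)
      simp [this]
    · intro i _ hi
      have : ¬ i ≤ n := fun h => hi (Finset.mem_range.2 (Nat.lt_succ_of_le h))
      simp [this]
  have hsumW : ∑ i, W i = τ := by
    rw [hτ, ← hsum (T ℝ n) (by simp [degree_T]; exact_mod_cast n.lt_succ_self)]
    refine Finset.sum_congr rfl fun i _ => ?_
    simp only [hW, hy]; split_ifs with hi
    · rw [eval_T_real_node (Finset.mem_Iic.2 hi), mul_right_comm, ← mul_pow]; simp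
    · simp
  set xs : EuclideanSpace ℝ (Fin d) := WithLp.toLp 2 fun i => r / √τ * √(W i) with hxs
  set z : EuclideanSpace ℝ (Fin d) := WithLp.toLp 2 fun i => (-1) ^ (i : ℕ) * √(W i) with hz
  have hzn : ‖z‖ = √τ := by
    rw [EuclideanSpace.norm_eq, ← hsumW]
    congr 1
    refine Finset.sum_congr rfl fun i _ => ?_
    simp [hz, Real.sq_sqrt (hW0 i)]
  have hxn : ‖xs‖ = r := by
    rw [EuclideanSpace.norm_eq, ← Real.sqrt_sq hr.le]
    congr 1
    have : ∀ i, ‖xs i‖ ^ 2 = r ^ 2 / τ * W i := fun i => by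
      simp only [hxs, Real.norm_eq_abs, sq_abs]
      rw [mul_pow, div_pow, Real.sq_sqrt (hW0 i), Real.sq_sqrt hτ0.le]
    rw [Finset.sum_congr rfl fun i _ => this i, ← Finset.mul_sum, hsumW, div_mul_cancel₀ _ hτ0.ne']
  have hzW : ∀ i, √(W i) * √(W i) = W i := fun i => Real.mul_self_sqrt (hW0 i)
  set b : Fin d → ℝ := fun i => h * (κ - y i) * xs i with hb
  refine ⟨y, b, xs, hyI, ⟨⟨0, by omega⟩, by simp [hy, node_eq_one]⟩,
    ⟨⟨n, by omega⟩, by simp [hy, node_eq_neg_one (by omega : n ≠ 0)]⟩, hxn, fun i => rfl,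
    fun j hj => ?_, fun u hu => ?_⟩
  · refine diagKrylov_lt_succ (e := Fin.castLE hnd) (fun i j hij => ?_) (fun i => ?_) hj
    · have hi : (i : ℕ) ≤ n := by omega
      have hj : (j : ℕ) ≤ n := by omega
      simp only [Function.comp_apply, hy, Fin.val_castLE, hi, hj, if_true] at hij
      exact Fin.ext ((strictAntiOn_node n).injOn (by simp [hi]) (by simp [hj]) hij)
    · have hi : (i : ℕ) ≤ n := by omega
      have h1 : 0 < κ - y (Fin.castLE hnd i) := by linarith [(hyI (Fin.castLE hnd i)).2]
      have h2 : 0 < W (Fin.castLE hnd i) := by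
        simp only [hW, Fin.val_castLE, hi, if_true]; exact hw _ hi
      simp only [hb, hxs]
      positivity
  · obtain ⟨q, hqd, rfl⟩ := mem_diagKrylov.1 hu
    -- `z` pairs with `q(Y) b` as the interpolation formula does with `(κ - X) * q`, which has
    -- degree at most `n` and vanishes at `κ`.
    have hzu : ⟪z, polyDiag y b q⟫_ℝ = 0 := by
      have h2 := hsum _ (degree_affine_mul_lt κ 1 hqd)
      simp only [eval_mul, eval_sub, eval_C, eval_X, one_mul, sub_self, zero_mul] at h2
      rw [PiLp.inner_apply]
      calc _ = ∑ i : Fin d, h * (r / √τ) * ((-1) ^ (i : ℕ) * W i * ((κ - y i) * q.eval (y i))) := by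
            refine Finset.sum_congr rfl fun i _ => ?_
            simp only [hz, polyDiag_apply, hb, hxs, RCLike.inner_apply, conj_trivial]
            linear_combination ((-1) ^ (i : ℕ) * (r / √τ) * h * (κ - y i) * q.eval (y i)) * hzW i
        _ = 0 := by rw [← Finset.mul_sum, h2, mul_zero]
    have hzx : ⟪z, xs⟫_ℝ = r / √τ := by
      have h2 := hsum 1 (by rw [degree_one]; exact_mod_cast n.succ_pos)
      simp only [eval_one, mul_one] at h2
      rw [PiLp.inner_apply]
      calc _ = ∑ i : Fin d, (r / √τ) * ((-1) ^ (i : ℕ) * W i) := by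
            refine Finset.sum_congr rfl fun i _ => ?_
            simp only [hz, hxs, RCLike.inner_apply, conj_trivial]
            linear_combination ((-1) ^ (i : ℕ) * (r / √τ)) * hzW i
        _ = _ := by rw [← Finset.mul_sum, h2, mul_one]
    have h1 := real_inner_le_norm z (xs - polyDiag y b q)
    rw [inner_sub_right, hzu, hzx, sub_zero, hzn, norm_sub_rev] at h1
    have h3 : 0 < √τ := Real.sqrt_pos.2 hτ0
    calc r / τ = r / √τ / √τ := by rw [div_div, Real.mul_self_sqrt hτ0.le]
      _ ≤ _ := by rw [div_le_iff₀ h3, mul_comm]; exact h1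

end

/-! ### Rotated objectives and the lower bounds -/

/-- The matrix, in the standard basis, of the operator `U⁻¹ A U`. -/
noncomputable def rotateMatrix (A : Matrix (Fin d) (Fin d) ℝ)
    (U : EuclideanSpace ℝ (Fin d) ≃ₗᵢ[ℝ] EuclideanSpace ℝ (Fin d)) : Matrix (Fin d) (Fin d) ℝ :=
  Matrix.toEuclideanLin.symm (U.symm.toLinearEquiv.conj (Matrix.toEuclideanLin A))

theorem toEuclideanLin_rotateMatrix (A : Matrix (Fin d) (Fin d) ℝ)
    (U : EuclideanSpace ℝ (Fin d) ≃ₗᵢ[ℝ] EuclideanSpace ℝ (Fin d)) :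
    Matrix.toEuclideanLin (rotateMatrix A U) =
      U.symm.toLinearEquiv.conj (Matrix.toEuclideanLin A) :=
  LinearEquiv.apply_symm_apply _ _

theorem toEuclideanLin_rotateMatrix_apply (A : Matrix (Fin d) (Fin d) ℝ)
    (U : EuclideanSpace ℝ (Fin d) ≃ₗᵢ[ℝ] EuclideanSpace ℝ (Fin d)) (x : EuclideanSpace ℝ (Fin d)) :
    Matrix.toEuclideanLin (rotateMatrix A U) x = U.symm (Matrix.toEuclideanLin A (U x)) := by
  rw [toEuclideanLin_rotateMatrix]; rfl

theorem regQuad_rotateMatrix (A : Matrix (Fin d) (Fin d) ℝ) (b : EuclideanSpace ℝ (Fin d))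
    (s p : ℝ) (U : EuclideanSpace ℝ (Fin d) ≃ₗᵢ[ℝ] EuclideanSpace ℝ (Fin d)) :
    regQuad (rotateMatrix A U) (U.symm b) s p = fun x => regQuad A b s p (U x) := by
  funext x
  have h : ∀ u v, ⟪u, U.symm v⟫_ℝ = ⟪U u, v⟫_ℝ := fun u v => by
    rw [← U.inner_map_map, U.apply_symm_apply]
  have h' : ∀ u v, ⟪U.symm u, v⟫_ℝ = ⟪u, U v⟫_ℝ := fun u v => by
    rw [← U.inner_map_map, U.apply_symm_apply]
  rw [regQuad, regQuad, toEuclideanLin_rotateMatrix_apply, h, h', U.norm_map]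

theorem posSemidef_rotateMatrix {A : Matrix (Fin d) (Fin d) ℝ} (hA : A.PosSemidef)
    (U : EuclideanSpace ℝ (Fin d) ≃ₗᵢ[ℝ] EuclideanSpace ℝ (Fin d)) :
    (rotateMatrix A U).PosSemidef := by
  rw [← Matrix.isPositive_toEuclideanLin_iff] at hA ⊢
  have h' : ∀ u v, ⟪U.symm u, v⟫_ℝ = ⟪u, U v⟫_ℝ := fun u v => by
    rw [← U.inner_map_map, U.apply_symm_apply]
  refine ⟨fun x y => ?_, fun x => ?_⟩
  · rw [toEuclideanLin_rotateMatrix_apply, toEuclideanLin_rotateMatrix_apply, h', hA.1,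
      ← U.inner_map_map x, U.apply_symm_apply]
  · rw [toEuclideanLin_rotateMatrix_apply, h']
    exact hA.2 _

theorem spectrum_rotateMatrix (A : Matrix (Fin d) (Fin d) ℝ)
    (U : EuclideanSpace ℝ (Fin d) ≃ₗᵢ[ℝ] EuclideanSpace ℝ (Fin d)) :
    spectrum ℝ (rotateMatrix A U) = spectrum ℝ A := by
  rw [← Matrix.spectrum_toLpLin 2, toEuclideanLin_rotateMatrix,
    ← Matrix.spectrum_toLpLin (A := A) 2]
  exact AlgEquiv.spectrum_eq (U.symm.toLinearEquiv.conjAlgEquiv ℝ) _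

theorem gradient_regQuad_eq_zero {A : Matrix (Fin d) (Fin d) ℝ} (hA : A.IsHermitian)
    {b xs : EuclideanSpace ℝ (Fin d)} {s p : ℝ} (hp : 2 ≤ p)
    (h : Matrix.toEuclideanLin A xs + (s * ‖xs‖ ^ (p - 2)) • xs = b) :
    gradient (regQuad A b s p) xs = 0 := by
  rw [(hasGradientAt_regQuad hA b s hp xs).gradient, ← h]
  abel

theorem expFactor_nonneg (c Q : ℝ) : 0 ≤ expFactor c Q := by
  unfold expFactor; split_ifs <;> positivity

theorem expFactor_rpow (c Q : ℝ) {t : ℝ} (ht : 0 < t) :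
    expFactor c Q ^ t = expFactor (c * t) Q := by
  unfold expFactor
  split_ifs
  · exact Real.zero_rpow ht.ne'
  · rw [← Real.exp_mul]; ring_nf

theorem expFactor_of_one_lt {c Q : ℝ} (h : 1 < Q) : expFactor c Q = exp (-(c / (√Q - 1))) := by
  rw [expFactor, if_neg h.ne']

/-- The hard instance for a given method when `μ < L`: the diagonal one, rotated against the
method. The Chebyshev bound would even allow the exponent `4 * N` in place of `8 * N`. -/
theorem exists_hard_regQuad {p s μ L r : ℝ} (hp : 2 ≤ p) (hs : 0 < s) (hμ : 0 ≤ μ) (hμL : μ < L)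
    (hr : 0 < r) {N : ℕ} (hN : 1 ≤ N) (hNd : 2 * N + 1 ≤ d) (M : FirstOrderMethod d) :
    ∃ (A : Matrix (Fin d) (Fin d) ℝ) (b xs : EuclideanSpace ℝ (Fin d)),
      A.PosSemidef ∧ IsLeast (spectrum ℝ A) μ ∧ IsGreatest (spectrum ℝ A) L ∧
      gradient (regQuad A b s p) xs = 0 ∧ ‖xs‖ = r ∧
      r * expFactor (8 * N) (modifiedCond p s μ L r) ≤
        ‖M.iterate (regQuad A b s p) N - xs‖ := by
  have hσ : 0 < s * r ^ (p - 2) := by positivity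
  set σ := s * r ^ (p - 2) with hσd
  set Q := modifiedCond p s μ L r with hQd
  have hQ : Q = (L + σ) / (μ + σ) := rfl
  have hQ1 : 1 < Q := by rw [hQ, one_lt_div (by linarith)]; linarith
  set κ := (Q + 1) / (Q - 1) with hκd
  have hκ : 1 < κ := by rw [hκd, one_lt_div (by linarith)]; linarith
  have hκe : (L - μ) / 2 * κ = (L + μ) / 2 + σ := by
    have h1 : L - μ ≠ 0 := by linarith
    have h2 : μ + σ ≠ 0 := by linarith
    have h3 : Q - 1 = (L - μ) / (μ + σ) := by rw [hQ]; field_simp; ring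
    rw [hκd, h3, hQ]
    field_simp
    ring
  -- `A = (L + μ) / 2 - (L - μ) / 2 * Y` and `A + σ = (L - μ) / 2 * (κ - Y)` with `y ∈ [-1, 1]`;
  -- the node `1` gives the eigenvalue `μ`, the node `-1` gives `L`.
  obtain ⟨y, b, xs, hyI, ⟨i₁, hi₁⟩, ⟨i₂, hi₂⟩, hxs, hb, hlt, hdist⟩ :=
    exists_hard_diagonal (n := 2 * N) (by omega) hNd hκ (by linarith : 0 < (L - μ) / 2) hr
  set a : Fin d → ℝ := fun i => (L + μ) / 2 - (L - μ) / 2 * y i with ha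
  have haI : ∀ i, a i ∈ Set.Icc μ L := fun i => by
    have := hyI i
    constructor
    · simp only [ha]; nlinarith [this.2]
    · simp only [ha]; nlinarith [this.1]
  have hA : (Matrix.diagonal a).PosSemidef :=
    Matrix.PosSemidef.diagonal fun i => hμ.trans (haI i).1
  have hspec : spectrum ℝ (Matrix.diagonal a) = Set.range a := spectrum_diagonal a
  have hcrit : Matrix.toEuclideanLin (Matrix.diagonal a) xs + (s * ‖xs‖ ^ (p - 2)) • xs =
      WithLp.toLp 2 b := by
    rw [hxs]
    ext i
    simp only [PiLp.add_apply, PiLp.smul_apply, Matrix.toLpLin_apply, Matrix.mulVec_diagonal,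
      smul_eq_mul, ← hb, ha]
    linear_combination (-xs i) * hκe
  have hgrad0 := gradient_regQuad_eq_zero hA.1 hp hcrit
  obtain ⟨U, hU⟩ := exists_resisting_rotation M (regQuad (Matrix.diagonal a) (WithLp.toLp 2 b) s p)
    (diagKrylov y b) (diagKrylov_mono y b) (fun j x hx => by
      rw [(hasGradientAt_regQuad hA.1 _ s hp x).gradient]
      exact add_mem (sub_mem (diagonal_affine_mem_diagKrylov _ _ hx)
        (diagKrylov_mono y b (by omega) (toLp_mem_diagKrylov_one y b)))
        (Submodule.smul_mem _ _ (diagKrylov_mono y b j.le_succ hx))) N (fun j hj => hlt j hj.le)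
  refine ⟨rotateMatrix (Matrix.diagonal a) U, U.symm (WithLp.toLp 2 b), U.symm xs,
    posSemidef_rotateMatrix hA U, ?_, ?_, ?_, by rw [U.symm.norm_map, hxs], ?_⟩
  · rw [spectrum_rotateMatrix, hspec]
    exact ⟨⟨i₁, by simp only [ha, hi₁]; ring⟩, by rintro _ ⟨i, rfl⟩; exact (haI i).1⟩
  · rw [spectrum_rotateMatrix, hspec]
    exact ⟨⟨i₂, by simp only [ha, hi₂]; ring⟩, by rintro _ ⟨i, rfl⟩; exact (haI i).2⟩
  · rw [regQuad_rotateMatrix, gradient_comp_linearIsometryEquiv, U.apply_symm_apply, hgrad0,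
      map_zero]
  · rw [regQuad_rotateMatrix, ← U.norm_map, map_sub, U.apply_symm_apply]
    refine le_trans ?_ (hdist _ (hU N le_rfl))
    have hT := chebyshev_T_eval_le (2 * N) hQ1
    have hT0 := zero_lt_one.trans_le
      (Polynomial.Chebyshev.one_le_eval_T_real ((2 * N : ℕ) : ℤ) hκ.le)
    have hQs : 0 < √Q - 1 := by
      have : 1 < √Q := by rwa [Real.lt_sqrt zero_le_one, one_pow]
      linarith
    rw [expFactor_of_one_lt hQ1, le_div_iff₀ hT0, mul_assoc]
    refine mul_le_of_le_one_right hr.le ?_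
    calc _ ≤ exp (-(8 * N / (√Q - 1))) * exp (2 * (2 * N : ℕ) / (√Q - 1)) := by gcongr
      _ ≤ 1 := by
        rw [← Real.exp_add, Real.exp_le_one_iff, neg_add_eq_sub, ← sub_div]
        refine div_nonpos_of_nonpos_of_nonneg ?_ hQs.le
        push_cast
        linarith [(Nat.cast_nonneg N : (0 : ℝ) ≤ N)]

/-- For `μ = L` the distance bound is vacuous, and any critical point of norm `r` will do. -/
theorem exists_scalar_regQuad {p s μ r : ℝ} (hp : 2 ≤ p) (hμ : 0 ≤ μ) (hr : 0 < r) (hd : 0 < d) :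
    ∃ (A : Matrix (Fin d) (Fin d) ℝ) (b xs : EuclideanSpace ℝ (Fin d)),
      A.PosSemidef ∧ IsLeast (spectrum ℝ A) μ ∧ IsGreatest (spectrum ℝ A) μ ∧
      gradient (regQuad A b s p) xs = 0 ∧ ‖xs‖ = r := by
  have : Nonempty (Fin d) := ⟨⟨0, hd⟩⟩
  have hA : (Matrix.diagonal fun _ : Fin d => μ).PosSemidef :=
    Matrix.PosSemidef.diagonal fun _ => hμ
  refine ⟨_, _, EuclideanSpace.single ⟨0, hd⟩ r, hA, ?_, ?_,
    gradient_regQuad_eq_zero hA.1 hp rfl, ?_⟩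
  · rw [spectrum_diagonal, Set.range_const]; exact isLeast_singleton
  · rw [spectrum_diagonal, Set.range_const]; exact isGreatest_singleton
  · rw [PiLp.norm_single, Real.norm_of_nonneg hr.le]

theorem theorem4 (p s μ L r : ℝ) (hp : 2 ≤ p) (hs : 0 < s) (hμ : 0 ≤ μ) (hμL : μ ≤ L)
    (hr : 0 < r) (d N : ℕ) (hN : 1 ≤ N) (hNd : (N : ℝ) ≤ ((d : ℝ) - 1) / 2)
    (M : FirstOrderMethod d) :
    1 ≤ modifiedCond p s μ L r ∧
    ∃ (A : Matrix (Fin d) (Fin d) ℝ) (b xstar : EuclideanSpace ℝ (Fin d)),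
      A.PosSemidef ∧
      IsLeast (spectrum ℝ A) μ ∧
      IsGreatest (spectrum ℝ A) L ∧
      (∀ y : EuclideanSpace ℝ (Fin d), y ≠ xstar → regQuad A b s p xstar < regQuad A b s p y) ∧
      ‖xstar‖ = r ∧
      ‖M.iterate (regQuad A b s p) N - xstar‖ ≥
        r * expFactor (8 * N) (modifiedCond p s μ L r) ∧
      regQuad A b s p (M.iterate (regQuad A b s p) N) - regQuad A b s p xstar ≥
        s / (p * 2 ^ (p - 2)) * r ^ p * expFactor (8 * p * N) (modifiedCond p s μ L r) ∧
      ‖gradient (regQuad A b s p) (M.iterate (regQuad A b s p) N)‖ ≥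
        2 ^ (2 - p) * s / (p - 1) ^ ((p - 1) / p) * r ^ (p - 1) *
          expFactor (8 * (p - 1) * N) (modifiedCond p s μ L r) := by
  have hσ : 0 < s * r ^ (p - 2) := by positivity
  refine ⟨by rw [modifiedCond, one_le_div (by linarith)]; linarith, ?_⟩
  have hd : 2 * N + 1 ≤ d := by
    have : (2 * N + 1 : ℝ) ≤ d := by linarith
    exact_mod_cast this
  obtain ⟨A, b, xs, hA, hl, hg, hgrad, hxs, hdist⟩ :
      ∃ (A : Matrix (Fin d) (Fin d) ℝ) (b xs : EuclideanSpace ℝ (Fin d)),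
        A.PosSemidef ∧ IsLeast (spectrum ℝ A) μ ∧ IsGreatest (spectrum ℝ A) L ∧
        gradient (regQuad A b s p) xs = 0 ∧ ‖xs‖ = r ∧
        r * expFactor (8 * N) (modifiedCond p s μ L r) ≤
          ‖M.iterate (regQuad A b s p) N - xs‖ := by
    rcases hμL.lt_or_eq with h | rfl
    · exact exists_hard_regQuad hp hs hμ h hr hN hd M
    · obtain ⟨A, b, xs, hA, hl, hg, hgrad, hxs⟩ :=
        exists_scalar_regQuad (s := s) hp hμ hr (by omega : 0 < d)
      refine ⟨A, b, xs, hA, hl, hg, hgrad, hxs, ?_⟩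
      rw [modifiedCond, div_self (by linarith), expFactor, if_pos rfl, mul_zero]
      exact norm_nonneg _
  set x := M.iterate (regQuad A b s p) N
  set E := expFactor (8 * N) (modifiedCond p s μ L r)
  have hE : 0 ≤ E := expFactor_nonneg _ _
  have hpow : ∀ t : ℝ, 0 < t →
      r ^ t * expFactor (8 * t * N) (modifiedCond p s μ L r) ≤ ‖x - xs‖ ^ t := fun t ht => by
    have := Real.rpow_le_rpow (by positivity) hdist ht.le
    rwa [Real.mul_rpow hr.le hE, expFactor_rpow _ _ ht, mul_right_comm] at this
  refine ⟨A, b, xs, hA, hl, hg, fun y hy => ?_, hxs, hdist, ?_, ?_⟩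
  · have h1 := regQuad_sub_ge hA hs.le hp hgrad y
    have h2 : 0 < ‖y - xs‖ := norm_pos_iff.2 (sub_ne_zero.2 hy)
    have h3 : 0 < s / (p * 2 ^ (p - 2)) * ‖y - xs‖ ^ p := by positivity
    linarith
  · refine le_trans ?_ (regQuad_sub_ge hA hs.le hp hgrad x)
    rw [mul_assoc]
    gcongr
    exact hpow p (by linarith)
  · refine le_trans ?_ (norm_gradient_regQuad_ge hA hs.le hp hgrad x)
    -- the factor `(p - 1) ^ ((p - 1) / p) ≥ 1` only weakens the bound
    have h1 : 2 ^ (2 - p) * s / (p - 1) ^ ((p - 1) / p) ≤ 2 ^ (2 - p) * s :=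
      div_le_self (by positivity)
        (Real.one_le_rpow (by linarith) (div_nonneg (by linarith) (by linarith)))
    rw [mul_assoc]
    exact mul_le_mul h1 (hpow (p - 1) (by linarith))
      (mul_nonneg (by positivity) (expFactor_nonneg _ _)) (by positivity)
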